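/- Let arms $1,\dots,K$ have reward vectors $X(t)=(X_1(t),\dots,X_K(t))\in[0,1]^K$, $t=1,2,\dots$, that are i.i.d. over time, with mean rewards $\mu_j=\mathbb E[X_j(t)]$ and gaps $\Delta_j=\max_i\mu_i-\mu_j$, and let $\epsilon>0$. Algorithm Anytime-Lazy-UCB (which does not know the horizon) works as follows. Each arm $j$ has arrays with indices $r=0,1,2,\dots$ and sizes $2^r$, which are filled one after the other with the successive observed rewards of arm $j$. When array $r$ of arm $j$ becomes full, an independent noise variable from the centred Laplace distribution with scale $1/\epsilon$ is added to the sum of its $2^r$ entries, and the result divided by $2^r$ is the current private mean $\widetilde\mu_j$ of arm $j$ (earlier arrays are forgotten). In rounds $1,\dots,K$ each arm is pulled once. In every round $t>K$ the learner pulls an arm $J_t$, with ties broken arbitrarily (but not using the rewards of round $t$ or later), that maximizes $$\widetilde\mu_j+\sqrt{\frac{3\ln t}{2^{r_j}}}+\frac{3\ln t}{\epsilon\,2^{r_j}},$$ where $r_j$ is the index of the most recently filled array of arm $j$ at the end of round $t-1$ and $\widetilde\mu_j$ is the private mean computed from that array. Then there is an absolute constant $C$ such that for all such $K$, reward distributions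 and $\epsilon$, and all $T\ge 2$, the pseudo-regret $\mathcal R(T)=\max_j\mathbb E\big[\sum_{t=1}^T X_j(t)-\sum_{t=1}^T X_{J_t}(t)\big]$ satisfies $$\mathcal R(T)\le C\sum_{j:\,\Delta_j>0}\frac{\log_2 T}{\min\{\Delta_j,\epsilon\}}.$$ -/

import Mathlib

open MeasureTheory ProbabilityTheory

namespace PrivateBandit

noncomputable section

/-! Arms are the elements of `Fin K`; rounds are numbered `1, 2, 3, …` (the index `0` is unused).
`x t j` is the reward of arm `j` in round `t`, `J t` is the arm pulled in round `t`, and `l j r` is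
the noise added to the sum of array `r` of arm `j` when that array becomes full. -/

/-- The centred Laplace distribution on `ℝ` with scale `b > 0`. -/
def laplace (b : ℝ) : Measure ℝ :=
  volume.withDensity fun y => ENNReal.ofReal (Real.exp (-|y| / b) / (2 * b))

/-- `O_j(t)`: the number of pulls of arm `j` by the end of round `t`. -/
def pulls {K : ℕ} (J : ℕ → Fin K) (j : Fin K) (t : ℕ) : ℕ :=
  ((Finset.Icc 1 t).filter fun s => J s = j).card

/-- The size `2 ^ r` of the array with index `r`. -/
def arraySize (r : ℕ) : ℕ := 2 ^ r

/-- The total size of the arrays with indices `0, …, r`. -/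
def totalSize (r : ℕ) : ℕ := ∑ i ∈ Finset.range (r + 1), arraySize i

/-- `r_j(t)`: the index of the most recent array of arm `j` that is full by the end of round `t`.
(Array `r` is full when all the slots of arrays `0, …, r` are used, i.e. `totalSize r ≤ O_j(t)`;
since `r ≤ totalSize r`, the search up to `O_j(t)` is exhaustive.) -/
def lastFull {K : ℕ} (J : ℕ → Fin K) (j : Fin K) (t : ℕ) : ℕ :=
  Nat.findGreatest (fun r => totalSize r ≤ pulls J j t) (pulls J j t)

/-- The rounds by the end of round `t` whose observation was inserted into array `r` of arm `j`:
the arrays are filled one after the other, so it is array `r` that receives the `n`-th observation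
of arm `j` when `totalSize r - arraySize r < n ≤ totalSize r`. -/
def arrayRounds {K : ℕ} (J : ℕ → Fin K) (j : Fin K) (r t : ℕ) : Finset ℕ :=
  (Finset.Icc 1 t).filter fun s =>
    J s = j ∧ totalSize r < pulls J j s + arraySize r ∧ pulls J j s ≤ totalSize r

/-- The private empirical mean of arm `j` at the end of round `t`: the noisy sum of its most
recently filled array, divided by the size of that array. -/
def privateMean {K : ℕ} (x : ℕ → Fin K → ℝ) (l : Fin K → ℕ → ℝ) (J : ℕ → Fin K)
    (j : Fin K) (t : ℕ) : ℝ :=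
  ((∑ s ∈ arrayRounds J j (lastFull J j t) t, x s j) + l j (lastFull J j t)) /
    (arraySize (lastFull J j t) : ℝ)

/-- The upper confidence bound of arm `j` at the beginning of round `t` (for `t ≥ 1`), built from
what is known at the end of round `t - 1`. -/
def ucb {K : ℕ} (ε : ℝ) (x : ℕ → Fin K → ℝ) (l : Fin K → ℕ → ℝ) (J : ℕ → Fin K)
    (j : Fin K) (t : ℕ) : ℝ :=
  privateMean x l J j (t - 1)
    + Real.sqrt (3 * Real.log t / (arraySize (lastFull J j (t - 1)) : ℝ))
    + 3 * Real.log t / (ε * (arraySize (lastFull J j (t - 1)) : ℝ))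

/-- `J` is a run of Anytime-Lazy-UCB with privacy parameter `ε` on the rewards `x` and the noise
`l`: the first `K` rounds pull every arm once, and every later round pulls an arm with the largest
upper confidence bound, ties being broken arbitrarily. -/
def IsRun {K : ℕ} (ε : ℝ) (x : ℕ → Fin K → ℝ) (l : Fin K → ℕ → ℝ) (J : ℕ → Fin K) : Prop :=
  (∀ i : Fin K, J ((i : ℕ) + 1) = i) ∧
    ∀ t : ℕ, K < t → ∀ i : Fin K, ucb ε x l J i t ≤ ucb ε x l J (J t) t

/-- On the probability space `(Ω, P)`, the learner running Anytime-Lazy-UCB with parameter `ε`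
plays `J` against a stochastic environment whose reward vectors `X 1, X 2, …` are i.i.d. with
law `ν`, and `L` is the noise of the algorithm. -/
structure IsAnytimeLazyUCB {Ω : Type*} [MeasurableSpace Ω] (P : Measure Ω) {K : ℕ} (ε : ℝ)
    (ν : Measure (Fin K → ℝ)) (X : ℕ → Ω → Fin K → ℝ) (L : Ω → Fin K → ℕ → ℝ)
    (J : ℕ → Ω → Fin K) : Prop where
  measurable_reward : ∀ t, Measurable (X t)
  measurable_noise : Measurable L
  measurable_pull : ∀ t, Measurable (J t)
  /-- The reward vector of every round has law `ν`. -/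
  reward_law : ∀ t, 1 ≤ t → HasLaw (X t) ν P
  /-- The noise variables are Laplace with scale `1 / ε` … -/
  noise_law : ∀ j r, HasLaw (fun ω => L ω j r) (laplace (1 / ε)) P
  /-- … and mutually independent. -/
  noise_indep : iIndepFun (fun (p : Fin K × ℕ) ω => L ω p.1 p.2) P
  /-- The reward vector of round `t` is independent of the earlier reward vectors, of the noise
  and of the arms chosen up to and including round `t` (the learner chooses `J t` without seeing
  `X t`). In particular `X 1, X 2, …` are independent of one another and of the noise. -/
  reward_indep : ∀ t, 1 ≤ t →
    IndepFun (X t)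
      (fun ω => ((fun s : Set.Ico 1 t => X s ω), (fun s : Set.Icc 1 t => J s ω), L ω)) P
  /-- The arms are chosen by the algorithm. -/
  run : ∀ᵐ ω ∂P, IsRun ε (fun t => X t ω) (L ω) (fun t => J t ω)

/-- The mean reward `μ_j` of arm `j`. -/
def armMean {K : ℕ} (ν : Measure (Fin K → ℝ)) (j : Fin K) : ℝ := ∫ v, v j ∂ν

/-- The gap `Δ_j` between the largest mean reward and that of arm `j`. -/
def gap {K : ℕ} (ν : Measure (Fin K → ℝ)) (j : Fin K) : ℝ := (⨆ i, armMean ν i) - armMean ν j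

/-- The pseudo-regret after `T` rounds. -/
def regret {Ω : Type*} [MeasurableSpace Ω] (P : Measure Ω) {K : ℕ} (X : ℕ → Ω → Fin K → ℝ)
    (J : ℕ → Ω → Fin K) (T : ℕ) : ℝ :=
  ⨆ j : Fin K, ∫ ω, (∑ t ∈ Finset.Icc 1 T, X t ω j - ∑ t ∈ Finset.Icc 1 T, X t ω (J t ω)) ∂P

end

end PrivateBandit

/-! By independence of `X t` and `J t`, the regret is at most the sum over arms of the gap times the
expected number of pulls (`regret_le_sum_gap_mul`), so it suffices to bound the pulls of a
suboptimal arm `j` (`sum_measure_pull_le`). Array sizes double, so the last full array of an arm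
holds at least a quarter of its observations (`pulls_add_two_le`). If the arrays of `j` and of a
best arm are accurate, the index of the best arm exceeds its mean and the index of `j` is below its
mean plus twice the width; hence `j` is not pulled once its count exceeds a multiple of `log T / (Δ
* min Δ ε)` (`IsRun.pulls_le_of_accurate`). Inaccuracy in round `t` has probability at most `3 / t ^
2` per arm (`measure_not_accurate_le`), which is summable. Which rounds feed an array depends on
past rewards, so Hoeffding's inequality for a fixed sample does not apply. Instead, an exponential
supermartingale collects a factor only in the rounds that feed the array
(`lintegral_prod_piecewise_le_one`); once the array is full the number of factors is deterministic,
and Markov's inequality gives the tail. -/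

namespace PrivateBandit

/-! ### Pathwise analysis: counting pulls and comparing confidence bounds. -/

section Deterministic

variable {K : ℕ} (J : ℕ → Fin K) (j : Fin K)

theorem pulls_zero : pulls J j 0 = 0 := by simp [pulls]

theorem pulls_succ (t : ℕ) :
    pulls J j (t + 1) = pulls J j t + if J (t + 1) = j then 1 else 0 := by
  rw [pulls, ← Finset.insert_Icc_right_eq_Icc_add_one (by omega), Finset.filter_insert]
  split_ifs with h
  · rw [Finset.card_insert_of_notMem (by simp), pulls]
  · simp [pulls]

theorem pulls_le (t : ℕ) : pulls J j t ≤ t := by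
  simpa [pulls] using Finset.card_filter_le (Finset.Icc 1 t) fun s => J s = j

/-- The count takes each positive value at exactly one pull, so this counts the integers in `(a - c,
b]` reached by time `t`, with truncated subtraction. -/
theorem card_filter_pulls (a c b t : ℕ) (hab : a ≤ b + c) :
    ((Finset.Icc 1 t).filter fun s => J s = j ∧ a < pulls J j s + c ∧ pulls J j s ≤ b).card =
      min (pulls J j t) b - min (pulls J j t) (a - c) := by
  induction t with
  | zero => simp [pulls_zero]
  | succ t ih =>
    rw [← Finset.insert_Icc_right_eq_Icc_add_one (by omega), Finset.filter_insert]
    have hp := pulls_succ J j t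
    split_ifs with h
    · rw [Finset.card_insert_of_notMem (by simp), ih]
      rw [if_pos h.1] at hp
      omega
    · rw [ih]
      split_ifs at hp with hJ
      · have : ¬ (a < pulls J j (t + 1) + c ∧ pulls J j (t + 1) ≤ b) := fun h' => h ⟨hJ, h'⟩
        omega
      · rw [hp, add_zero]

theorem totalSize_add_one (r : ℕ) : totalSize r + 1 = 2 ^ (r + 1) := by
  induction r with
  | zero => simp [totalSize, arraySize]
  | succ r ih =>
    have h : totalSize (r + 1) = totalSize r + 2 ^ (r + 1) := by
      rw [totalSize, Finset.sum_range_succ, totalSize, arraySize]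
    rw [h, pow_succ 2 (r + 1)]
    omega

theorem totalSize_eq (r : ℕ) : totalSize r = 2 * arraySize r - 1 := by
  have := totalSize_add_one r
  rw [pow_succ] at this
  rw [arraySize]
  omega

theorem arraySize_pos (r : ℕ) : 0 < arraySize r := Nat.two_pow_pos r

theorem le_totalSize (r : ℕ) : r ≤ totalSize r := by
  have h1 := totalSize_add_one r
  have h2 : r + 1 < 2 ^ (r + 1) := Nat.lt_two_pow_self
  omega

theorem card_arrayRounds {r t : ℕ} (h : totalSize r ≤ pulls J j t) :
    (arrayRounds J j r t).card = arraySize r := by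
  have h1 := totalSize_eq r
  have h2 := arraySize_pos r
  rw [arrayRounds, card_filter_pulls J j _ _ _ _ (by omega)]
  omega

theorem lastFull_le_pulls (t : ℕ) : lastFull J j t ≤ pulls J j t := Nat.findGreatest_le _

/-- One pull is needed: without any, the search returns its default `0` although array `0` is empty.
-/
theorem totalSize_lastFull_le {t : ℕ} (h : 1 ≤ pulls J j t) :
    totalSize (lastFull J j t) ≤ pulls J j t := by
  refine Nat.findGreatest_spec (P := fun r => totalSize r ≤ pulls J j t) (Nat.zero_le _) ?_
  simpa [totalSize, arraySize] using h

/-- Array `r + 1` is not yet full, and the arrays up to it hold `4 * 2 ^ r - 1` entries. Forgetting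
old arrays thus costs only a constant factor. -/
theorem pulls_add_two_le (t : ℕ) : pulls J j t + 2 ≤ 4 * arraySize (lastFull J j t) := by
  have h : pulls J j t < totalSize (lastFull J j t + 1) := by
    by_contra! h
    have h1 := Nat.le_findGreatest (P := fun r => totalSize r ≤ pulls J j t)
      ((le_totalSize _).trans h) h
    rw [← lastFull] at h1
    omega
  have h1 := totalSize_add_one (lastFull J j t + 1)
  have h2 : 2 ^ (lastFull J j t + 1 + 1) = 4 * arraySize (lastFull J j t) := by
    rw [arraySize]; ring
  omega

theorem card_filter_pulls_le (b t : ℕ) :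
    ((Finset.Icc 1 t).filter fun s => J s = j ∧ pulls J j s ≤ b).card ≤ b := by
  -- With these values the lower constraint `0 < pulls J j s + 1` is vacuous.
  have h := card_filter_pulls J j 0 1 b t (by omega)
  simp only [Nat.succ_pos, true_and] at h
  rw [h]
  omega

/-- The error of the empirical mean of array `r` of arm `j` (before adding the noise), multiplied
by the number of its entries, if `m` is the mean reward of arm `j`. -/
noncomputable def centredSum (x : ℕ → Fin K → ℝ) (m : ℝ) (r t : ℕ) : ℝ :=
  ∑ s ∈ arrayRounds J j r t, (x s j - m)

theorem abs_privateMean_sub_lt {x : ℕ → Fin K → ℝ} {l : Fin K → ℕ → ℝ} {m a b : ℝ} {t : ℕ}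
    (h : 1 ≤ pulls J j t)
    (hx : |centredSum J j x m (lastFull J j t) t| < arraySize (lastFull J j t) * a)
    (hl : |l j (lastFull J j t)| ≤ arraySize (lastFull J j t) * b) :
    |privateMean x l J j t - m| < a + b := by
  have hc := card_arrayRounds J j (totalSize_lastFull_le J j h)
  rw [centredSum, Finset.sum_sub_distrib, Finset.sum_const, hc, nsmul_eq_mul] at hx
  have hn : (0 : ℝ) < arraySize (lastFull J j t) := by exact_mod_cast arraySize_pos _
  have he : privateMean x l J j t - m = ((∑ s ∈ arrayRounds J j (lastFull J j t) t, x s j -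
      arraySize (lastFull J j t) * m) + l j (lastFull J j t)) / arraySize (lastFull J j t) := by
    rw [privateMean]
    field_simp
    ring
  rw [he, abs_div, abs_of_pos hn, div_lt_iff₀ hn]
  refine (abs_add_le _ _).trans_lt ?_
  linarith

variable {J j}

theorem IsRun.one_le_pulls {ε : ℝ} {x : ℕ → Fin K → ℝ} {l : Fin K → ℕ → ℝ}
    (h : IsRun ε x l J) (i : Fin K) {t : ℕ} (ht : K < t) : 1 ≤ pulls J i (t - 1) := by
  refine Finset.card_pos.2 ⟨(i : ℕ) + 1, ?_⟩
  simp only [Finset.mem_filter, Finset.mem_Icc, h.1 i, and_true]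
  omega

/-- All the arrays of arm `j` that may be full at the beginning of round `t` are accurate. -/
def Accurate (J : ℕ → Fin K) (ε : ℝ) (x : ℕ → Fin K → ℝ) (l : Fin K → ℕ → ℝ) (j : Fin K) (m : ℝ)
    (t : ℕ) : Prop :=
  ∀ r < t, (totalSize r ≤ pulls J j (t - 1) → |centredSum J j x m r (t - 1)| <
    arraySize r * Real.sqrt (3 * Real.log t / arraySize r)) ∧ |l j r| ≤ 3 * Real.log t / ε

/-- The index of the last full array is at most `t - 1`, so accuracy for all `r < t` covers it
whatever it is. Strictness later excludes ties. -/
theorem Accurate.abs_sub_lt {ε : ℝ} (hε : 0 < ε) {x : ℕ → Fin K → ℝ} {l : Fin K → ℕ → ℝ} {m : ℝ}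
    {t : ℕ} (ht : 1 ≤ t) (hp : 1 ≤ pulls J j (t - 1)) (h : Accurate J ε x l j m t) :
    |privateMean x l J j (t - 1) - m| <
      Real.sqrt (3 * Real.log t / (arraySize (lastFull J j (t - 1)) : ℝ))
        + 3 * Real.log t / (ε * (arraySize (lastFull J j (t - 1)) : ℝ)) := by
  have h1 := lastFull_le_pulls J j (t - 1)
  have h2 := pulls_le J j (t - 1)
  obtain ⟨h3, h4⟩ := h (lastFull J j (t - 1)) (by omega)
  have hn : (0 : ℝ) < arraySize (lastFull J j (t - 1)) := by exact_mod_cast arraySize_pos _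
  refine abs_privateMean_sub_lt J j hp (h3 (totalSize_lastFull_le J j hp)) (h4.trans_eq ?_)
  field_simp

theorem two_mul_confidenceWidth_le {a b ε Δ n : ℝ} (hε : 0 < ε) (hΔ : 0 < Δ) (ha : 0 ≤ a) (hab : a ≤ b)
    (hn : 48 * b / (Δ * min Δ ε) ≤ n) (hn0 : 0 < n) :
    2 * (Real.sqrt (3 * a / n) + 3 * a / (ε * n)) ≤ Δ := by
  have hm : 0 < min Δ ε := lt_min hΔ hε
  rw [div_le_iff₀ (by positivity)] at hn
  have h1 : n * (Δ * min Δ ε) ≤ n * (Δ * Δ) := by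
    gcongr
    exact min_le_left _ _
  have h2 : n * (Δ * min Δ ε) ≤ n * (Δ * ε) := by
    gcongr
    exact min_le_right _ _
  -- This amounts to `48 * a ≤ n * Δ ^ 2`, the source of the constant 48; the noise term needs only
  -- 12.
  have h3 : Real.sqrt (3 * a / n) ≤ Δ / 4 := by
    rw [Real.sqrt_le_left (by positivity), div_le_iff₀ hn0]
    nlinarith
  have h4 : 3 * a / (ε * n) ≤ Δ / 4 := by
    rw [div_le_iff₀ (by positivity)]
    nlinarith
  linarith

/-- A run does not pull a suboptimal arm that was pulled often, as long as its arrays and the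
arrays of a better arm are accurate. -/
theorem IsRun.pulls_le_of_accurate {ε : ℝ} (hε : 0 < ε) {x : ℕ → Fin K → ℝ} {l : Fin K → ℕ → ℝ}
    (h : IsRun ε x l J) {i : Fin K} {m Δ : ℝ} (hΔ : 0 < Δ) {t T : ℕ} (ht : K < t) (htT : t ≤ T)
    (hJ : J t = j) (hj : Accurate J ε x l j m t) (hi : Accurate J ε x l i (m + Δ) t) :
    pulls J j (t - 1) ≤ ⌊192 * Real.log T / (Δ * min Δ ε)⌋₊ := by
  by_contra! hlt
  have h1 := hj.abs_sub_lt hε (by omega) (h.one_le_pulls j ht)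
  have h2 := hi.abs_sub_lt hε (by omega) (h.one_le_pulls i ht)
  have h3 := h.2 t ht i
  rw [hJ] at h3
  have hn : (0 : ℝ) < arraySize (lastFull J j (t - 1)) := by exact_mod_cast arraySize_pos _
  have ht1 : (1 : ℝ) ≤ t := by exact_mod_cast (by omega : 1 ≤ t)
  have h4 : 2 * (Real.sqrt (3 * Real.log t / (arraySize (lastFull J j (t - 1)) : ℝ))
        + 3 * Real.log t / (ε * (arraySize (lastFull J j (t - 1)) : ℝ))) ≤ Δ := by
    refine two_mul_confidenceWidth_le (b := Real.log T) hε hΔ (Real.log_nonneg ht1)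
      (Real.log_le_log (by linarith) (by exact_mod_cast htT)) ?_ hn
    have h5 := (Nat.lt_of_floor_lt hlt).le
    have h6 : ((pulls J j (t - 1) + 2 : ℕ) : ℝ) ≤ (4 * arraySize (lastFull J j (t - 1)) : ℕ) := by
      exact_mod_cast pulls_add_two_le J j (t - 1)
    push_cast at h6
    -- The factor 4 is the loss in `pulls_add_two_le`.
    have h7 : 192 * Real.log T / (Δ * min Δ ε) = 4 * (48 * Real.log T / (Δ * min Δ ε)) := by ring
    linarith
  rw [abs_lt] at h1 h2
  rw [ucb, ucb] at h3
  linarith [h1.2, h2.1]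

end Deterministic

/-! ### Probabilistic tools: exponential moments, Laplace tails, measurability. -/

open scoped ENNReal

/-- Hoeffding's lemma: a variable in `[0, 1]` is sub-Gaussian with variance proxy `1 / 4`. -/
theorem lintegral_exp_sub_le_one {Ω : Type*} [MeasurableSpace Ω] {P : Measure Ω}
    [IsProbabilityMeasure P] {Y : Ω → ℝ} (hY : AEMeasurable Y P)
    (hb : ∀ᵐ ω ∂P, Y ω ∈ Set.Icc (0 : ℝ) 1) (c : ℝ) :
    ∫⁻ ω, ENNReal.ofReal (Real.exp (c * (Y ω - P[Y]) - c ^ 2 / 8)) ∂P ≤ 1 := by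
  have h := hasSubgaussianMGF_of_mem_Icc hY hb
  have hm := h.mgf_le c
  have hi := h.integrable_exp_mul c
  simp only [Real.exp_sub]
  rw [← ofReal_integral_eq_lintegral_ofReal (hi.div_const _)
    (Filter.Eventually.of_forall fun ω => by positivity), integral_div]
  rw [ENNReal.ofReal_le_one, div_le_one (Real.exp_pos _)]
  refine hm.trans_eq ?_
  congr 1
  norm_num
  ring

/-- A product of nonnegative factors, each of which has mean at most `1` and is independent of the
past and in particular of the decision whether to include it, has mean at most `1`. -/
theorem lintegral_prod_piecewise_le_one {Ω : Type*} {mΩ : MeasurableSpace Ω} {P : Measure Ω}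
    [IsProbabilityMeasure P] {Y : ℕ → Ω → ℝ≥0∞} {D : ℕ → Ω → Prop}
    [∀ t ω, Decidable (D t ω)] {F : ℕ → MeasurableSpace Ω} (hF : ∀ t, F t ≤ mΩ)
    (hY : ∀ t, Measurable (Y t))
    (hYF : ∀ s t, 1 ≤ s → s < t → Measurable[F t] (Y s))
    (hDF : ∀ s t, 1 ≤ s → s ≤ t → MeasurableSet[F t] {ω | D s ω})
    (hind : ∀ t, 1 ≤ t → Indep (MeasurableSpace.comap (Y t) inferInstance) (F t) P)
    (hle : ∀ t, 1 ≤ t → ∫⁻ ω, Y t ω ∂P ≤ 1) (t : ℕ) :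
    ∫⁻ ω, ∏ s ∈ (Finset.Icc 1 t).filter (fun s => D s ω), Y s ω ∂P ≤ 1 := by
  simp only [Finset.prod_filter]
  induction t with
  | zero => simp
  | succ t ih =>
    set Z : Ω → ℝ≥0∞ := fun ω => ∏ s ∈ Finset.Icc 1 t, if D s ω then Y s ω else 1 with hZ
    have hZF : Measurable[F (t + 1)] Z := by
      refine Finset.measurable_prod _ fun s hs => ?_
      rw [Finset.mem_Icc] at hs
      exact Measurable.ite (hDF s _ hs.1 (by omega)) (hYF s _ hs.1 (by omega)) measurable_const
    have hD := hDF (t + 1) (t + 1) (by omega) le_rfl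
    -- The old product is split by whether the new factor is included. Both pieces are known to `F
    -- (t + 1)`, so the new factor is independent of `U`.
    set U : Ω → ℝ≥0∞ := fun ω => if D (t + 1) ω then Z ω else 0
    set V : Ω → ℝ≥0∞ := fun ω => if D (t + 1) ω then 0 else Z ω
    have hU : Measurable[F (t + 1)] U := Measurable.ite hD hZF measurable_const
    have hV : Measurable[F (t + 1)] V := Measurable.ite hD measurable_const hZF
    calc ∫⁻ ω, ∏ s ∈ Finset.Icc 1 (t + 1), (if D s ω then Y s ω else 1) ∂P
        = ∫⁻ ω, (Y (t + 1) ω * U ω + V ω) ∂P := by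
          refine lintegral_congr fun ω => ?_
          rw [Finset.prod_Icc_succ_top (by omega)]
          by_cases h : D (t + 1) ω <;> simp [U, V, h, hZ, mul_comm]
      _ = (∫⁻ ω, Y (t + 1) ω ∂P) * ∫⁻ ω, U ω ∂P + ∫⁻ ω, V ω ∂P := by
          rw [lintegral_add_right _ (hV.mono (hF _) le_rfl),
            lintegral_mul_eq_lintegral_mul_lintegral_of_independent_measurableSpace
              (hY (t + 1)).comap_le (hF (t + 1)) (hind (t + 1) (by omega))
              (comap_measurable _) hU]
      _ ≤ 1 * ∫⁻ ω, U ω ∂P + ∫⁻ ω, V ω ∂P := by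
          gcongr
          exact hle _ (by omega)
      _ = ∫⁻ ω, Z ω ∂P := by
          rw [one_mul, ← lintegral_add_right _ (hV.mono (hF _) le_rfl)]
          refine lintegral_congr fun ω => ?_
          by_cases h : D (t + 1) ω <;> simp [U, V, h]
      _ ≤ 1 := ih

theorem laplace_Ioi {b : ℝ} (hb : 0 < b) {c : ℝ} (hc : 0 ≤ c) :
    laplace b (Set.Ioi c) ≤ ENNReal.ofReal (Real.exp (-c / b) / 2) := by
  rw [laplace, withDensity_apply _ measurableSet_Ioi]
  have hb' : -(1 / b) < 0 := by simpa using hb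
  have h : Set.EqOn (fun y : ℝ => ENNReal.ofReal (Real.exp (-|y| / b) / (2 * b)))
      (fun y => ENNReal.ofReal (Real.exp (-(1 / b) * y) / (2 * b))) (Set.Ioi c) := by
    intro y hy
    have : |y| = y := abs_of_pos (hc.trans_lt hy)
    simp only [this]
    congr 3
    ring
  rw [setLIntegral_congr_fun measurableSet_Ioi h, ← ofReal_integral_eq_lintegral_ofReal
    ((integrableOn_exp_mul_Ioi hb' c).div_const _)
    (Filter.Eventually.of_forall fun ω => by positivity), integral_div, integral_exp_mul_Ioi hb']
  refine (congrArg _ ?_).le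
  rw [show -(1 / b) * c = -c / b by ring]
  field_simp

theorem laplace_Iio {b : ℝ} (hb : 0 < b) {c : ℝ} (hc : 0 ≤ c) :
    laplace b (Set.Iio (-c)) ≤ ENNReal.ofReal (Real.exp (-c / b) / 2) := by
  refine le_trans (le_of_eq ?_) (laplace_Ioi hb hc)
  rw [laplace, withDensity_apply _ measurableSet_Ioi, withDensity_apply _ measurableSet_Iio]
  have := (Measure.measurePreserving_neg (volume : Measure ℝ)).setLIntegral_comp_preimage_emb
    (MeasurableEquiv.neg ℝ).measurableEmbedding
    (fun y : ℝ => ENNReal.ofReal (Real.exp (-|y| / b) / (2 * b))) (Set.Ioi c)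
  simpa using this

theorem laplace_lt_abs {b : ℝ} (hb : 0 < b) {c : ℝ} (hc : 0 ≤ c) :
    laplace b {y | c < |y|} ≤ ENNReal.ofReal (Real.exp (-c / b)) := by
  have h : {y : ℝ | c < |y|} = Set.Ioi c ∪ Set.Iio (-c) := by
    ext y
    simp [lt_abs, lt_neg]
  rw [h]
  refine (measure_union_le _ _).trans ((add_le_add (laplace_Ioi hb hc) (laplace_Iio hb hc)).trans ?_)
  rw [← ENNReal.ofReal_add (by positivity) (by positivity), add_halves]

theorem sum_inv_sq_le (T : ℕ) : ∑ t ∈ Finset.Icc 1 T, 1 / (t : ℝ) ^ 2 ≤ 2 := by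
  -- The strengthened bound makes the induction telescope.
  suffices h : ∀ n : ℕ, ∑ t ∈ Finset.Icc 1 (n + 1), 1 / (t : ℝ) ^ 2 ≤ (2 : ℝ) - 1 / ((n : ℝ) + 1) by
    cases T with
    | zero => simp
    | succ n => exact (h n).trans (by simp; positivity)
  intro n
  induction n with
  | zero => norm_num
  | succ n ih =>
    rw [Finset.sum_Icc_succ_top (by omega)]
    push_cast
    have h : 1 / ((n : ℝ) + 1 + 1) ^ 2 ≤ 1 / (n + 1) - 1 / (n + 1 + 1) := by
      rw [div_sub_div _ _ (by positivity) (by positivity), div_le_div_iff₀ (by positivity)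
        (by positivity)]
      have : (0 : ℝ) ≤ n := by positivity
      nlinarith
    linarith

theorem sum_arrayRounds_mul_sub {K : ℕ} (J : ℕ → Fin K) (j : Fin K) (x : ℕ → Fin K → ℝ) (m c d : ℝ)
    {r t : ℕ} (h : totalSize r ≤ pulls J j t) :
    ∑ s ∈ arrayRounds J j r t, (c * (x s j - m) - d) =
      c * centredSum J j x m r t - arraySize r * d := by
  rw [Finset.sum_sub_distrib, ← Finset.mul_sum, Finset.sum_const, card_arrayRounds J j h,
    nsmul_eq_mul, centredSum]

/-- The information available when the arm of round `t` has been chosen. -/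
abbrev past {Ω : Type*} {K : ℕ} (X : ℕ → Ω → Fin K → ℝ) (L : Ω → Fin K → ℕ → ℝ) (J : ℕ → Ω → Fin K)
    (t : ℕ) : MeasurableSpace Ω :=
  MeasurableSpace.comap
    (fun ω => ((fun s : Set.Ico 1 t => X s ω), (fun s : Set.Icc 1 t => J s ω), L ω)) inferInstance

theorem measurable_past_reward {Ω : Type*} {K : ℕ} {X : ℕ → Ω → Fin K → ℝ}
    {L : Ω → Fin K → ℕ → ℝ} {J : ℕ → Ω → Fin K} {s t : ℕ} (hs : 1 ≤ s) (hst : s < t) :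
    Measurable[past X L J t] (X s) := by
  have h : Measurable fun p : (Set.Ico 1 t → Fin K → ℝ) × (Set.Icc 1 t → Fin K) ×
      (Fin K → ℕ → ℝ) => p.1 ⟨s, hs, hst⟩ := by fun_prop
  exact h.comp (comap_measurable _)

theorem measurable_past_pull {Ω : Type*} {K : ℕ} {X : ℕ → Ω → Fin K → ℝ}
    {L : Ω → Fin K → ℕ → ℝ} {J : ℕ → Ω → Fin K} {s t : ℕ} (hs : 1 ≤ s) (hst : s ≤ t) :
    Measurable[past X L J t] (J s) := by
  have h : Measurable fun p : (Set.Ico 1 t → Fin K → ℝ) × (Set.Icc 1 t → Fin K) ×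
      (Fin K → ℕ → ℝ) => p.2.1 ⟨s, hs, hst⟩ := by fun_prop
  exact h.comp (comap_measurable _)

theorem measurable_pulls {Ω : Type*} [MeasurableSpace Ω] {K : ℕ} {J : ℕ → Ω → Fin K} {t : ℕ}
    (hJ : ∀ s, 1 ≤ s → s ≤ t → Measurable (J s)) (j : Fin K) :
    Measurable fun ω => pulls (fun s => J s ω) j t := by
  simp only [pulls, Finset.card_filter]
  refine Finset.measurable_sum _ fun s hs => ?_
  rw [Finset.mem_Icc] at hs
  exact Measurable.ite (hJ s hs.1 hs.2 (measurableSet_singleton j)) measurable_const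
    measurable_const

/-! ### Concentration of the array sums and of the noise. -/

namespace IsAnytimeLazyUCB

variable {Ω : Type*} [MeasurableSpace Ω] {P : Measure Ω} {K : ℕ} {ε : ℝ}
  {ν : Measure (Fin K → ℝ)} {X : ℕ → Ω → Fin K → ℝ} {L : Ω → Fin K → ℕ → ℝ} {J : ℕ → Ω → Fin K}

theorem past_le (h : IsAnytimeLazyUCB P ε ν X L J) (t : ℕ) : past X L J t ≤ ‹MeasurableSpace Ω› := by
  have h1 := h.measurable_reward
  have h2 := h.measurable_pull
  have h3 := h.measurable_noise
  refine Measurable.comap_le ?_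
  fun_prop

theorem measurable_reward_apply (h : IsAnytimeLazyUCB P ε ν X L J) (t : ℕ) (j : Fin K) :
    Measurable fun ω => X t ω j :=
  (measurable_pi_apply j).comp (h.measurable_reward t)

theorem reward_mem_Icc (h : IsAnytimeLazyUCB P ε ν X L J)
    (hν : ∀ᵐ v ∂ν, ∀ j, v j ∈ Set.Icc (0 : ℝ) 1) {t : ℕ} (ht : 1 ≤ t) (j : Fin K) :
    ∀ᵐ ω ∂P, X t ω j ∈ Set.Icc (0 : ℝ) 1 := by
  rw [← (h.reward_law t ht).map_eq] at hν
  filter_upwards [ae_of_ae_map (h.measurable_reward t).aemeasurable hν] with ω hω using hω j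

theorem integrable_reward [IsProbabilityMeasure P] (h : IsAnytimeLazyUCB P ε ν X L J)
    (hν : ∀ᵐ v ∂ν, ∀ j, v j ∈ Set.Icc (0 : ℝ) 1) {t : ℕ} (ht : 1 ≤ t) (j : Fin K) :
    Integrable (fun ω => X t ω j) P :=
  Integrable.of_mem_Icc 0 1 (h.measurable_reward_apply t j).aemeasurable (h.reward_mem_Icc hν ht j)

theorem integral_reward (h : IsAnytimeLazyUCB P ε ν X L J) {t : ℕ} (ht : 1 ≤ t) (j : Fin K) :
    ∫ ω, X t ω j ∂P = armMean ν j := by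
  rw [armMean, ← (h.reward_law t ht).map_eq, integral_map (h.measurable_reward t).aemeasurable
    (measurable_pi_apply j).aestronglyMeasurable]

theorem armMean_mem_Icc [IsProbabilityMeasure P] (h : IsAnytimeLazyUCB P ε ν X L J)
    (hν : ∀ᵐ v ∂ν, ∀ j, v j ∈ Set.Icc (0 : ℝ) 1) (j : Fin K) :
    armMean ν j ∈ Set.Icc (0 : ℝ) 1 := by
  rw [← h.integral_reward le_rfl j]
  have hi := h.integrable_reward hν le_rfl j
  have hb := h.reward_mem_Icc hν le_rfl j
  constructor
  · refine integral_nonneg_of_ae ?_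
    filter_upwards [hb] with ω hω using hω.1
  · refine (integral_mono_ae hi (integrable_const 1) ?_).trans_eq (by simp)
    filter_upwards [hb] with ω hω using hω.2

/-- The factor of the exponential supermartingale that belongs to the reward of arm `j` in
round `t`. -/
noncomputable def expFactor (ν : Measure (Fin K → ℝ)) (X : ℕ → Ω → Fin K → ℝ) (j : Fin K) (c : ℝ)
    (t : ℕ) (ω : Ω) : ℝ≥0∞ :=
  ENNReal.ofReal (Real.exp (c * (X t ω j - armMean ν j) - c ^ 2 / 8))

theorem lintegral_expFactor_le_one [IsProbabilityMeasure P] (h : IsAnytimeLazyUCB P ε ν X L J)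
    (hν : ∀ᵐ v ∂ν, ∀ j, v j ∈ Set.Icc (0 : ℝ) 1) (j : Fin K) (c : ℝ) (r t : ℕ) :
    ∫⁻ ω, ∏ s ∈ arrayRounds (fun s => J s ω) j r t, expFactor ν X j c s ω ∂P ≤ 1 := by
  have hφ : Measurable fun v : Fin K → ℝ =>
      ENNReal.ofReal (Real.exp (c * (v j - armMean ν j) - c ^ 2 / 8)) := by fun_prop
  refine lintegral_prod_piecewise_le_one (Y := expFactor ν X j c) (F := past X L J)
    (D := fun s ω => J s ω = j ∧ totalSize r < pulls (fun s => J s ω) j s + arraySize r ∧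
      pulls (fun s => J s ω) j s ≤ totalSize r) h.past_le
    (fun t => hφ.comp (h.measurable_reward t))
    (fun s t hs hst => hφ.comp (measurable_past_reward hs hst)) ?_ ?_ ?_ t
  -- Whether round `s` feeds array `r` depends only on the pulls up to `s`, not on the reward of
  -- round `s`.
  · intro s t hs hst
    have h1 : Measurable[past X L J t] fun ω => pulls (fun s => J s ω) j s :=
      @measurable_pulls Ω (past X L J t) K J s
        (fun u hu hus => measurable_past_pull hu (hus.trans hst)) j
    have h2 : Measurable[past X L J t] (J s) := measurable_past_pull hs hst
    exact (h2 (measurableSet_singleton j)).inter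
      (h1 (.of_discrete (s := {n | totalSize r < n + arraySize r ∧ n ≤ totalSize r})))
  · intro t ht
    refine indep_of_indep_of_le_left (h.reward_indep t ht) ?_
    rw [show expFactor ν X j c t = (fun v : Fin K → ℝ =>
      ENNReal.ofReal (Real.exp (c * (v j - armMean ν j) - c ^ 2 / 8))) ∘ X t from rfl,
      ← MeasurableSpace.comap_comp]
    exact MeasurableSpace.comap_mono hφ.comap_le
  · intro t ht
    have := lintegral_exp_sub_le_one (h.measurable_reward_apply t j).aemeasurable
      (h.reward_mem_Icc hν ht j) c
    rwa [h.integral_reward ht] at this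

theorem measurable_prod_expFactor (h : IsAnytimeLazyUCB P ε ν X L J) (j : Fin K) (c : ℝ)
    (r t : ℕ) :
    Measurable fun ω => ∏ s ∈ arrayRounds (fun s => J s ω) j r t, expFactor ν X j c s ω := by
  simp only [arrayRounds, Finset.prod_filter]
  refine Finset.measurable_prod _ fun s _ => Measurable.ite ?_ ?_ measurable_const
  · exact (h.measurable_pull s (measurableSet_singleton j)).inter
      (measurable_pulls (fun s _ _ => h.measurable_pull s) j (.of_discrete
        (s := {n | totalSize r < n + arraySize r ∧ n ≤ totalSize r})))
  · have := h.measurable_reward_apply s j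
    unfold expFactor
    fun_prop

/-- Markov's inequality for the product of factors; on the event the array is full, so there are
exactly `arraySize r` of them. -/
theorem measure_le_centredSum [IsProbabilityMeasure P] (h : IsAnytimeLazyUCB P ε ν X L J)
    (hν : ∀ᵐ v ∂ν, ∀ j, v j ∈ Set.Icc (0 : ℝ) 1) (j : Fin K) (c d : ℝ) (r t : ℕ) :
    P {ω | totalSize r ≤ pulls (fun s => J s ω) j t ∧
      d ≤ c * centredSum (fun s => J s ω) j (fun s => X s ω) (armMean ν j) r t -
        arraySize r * (c ^ 2 / 8)} ≤ ENNReal.ofReal (Real.exp (-d)) := by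
  have h1 := mul_meas_ge_le_lintegral (μ := P) (h.measurable_prod_expFactor j c r t)
    (ENNReal.ofReal (Real.exp d))
  have h2 := h1.trans (h.lintegral_expFactor_le_one hν j c r t)
  rw [Real.exp_neg, ENNReal.ofReal_inv_of_pos (Real.exp_pos _), ENNReal.le_inv_iff_mul_le, mul_comm]
  refine le_trans ?_ h2
  refine mul_le_mul_right (measure_mono fun ω hω => ?_) _
  have h3 := hω.2
  rw [← sum_arrayRounds_mul_sub _ _ _ _ _ _ hω.1] at h3
  simp only [Set.mem_ofPred_eq, expFactor]
  rw [← ENNReal.ofReal_prod_of_nonneg (fun s _ => by positivity), ← Real.exp_sum]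
  exact ENNReal.ofReal_le_ofReal (Real.exp_le_exp.2 h3)

theorem measure_le_abs_centredSum [IsProbabilityMeasure P] (h : IsAnytimeLazyUCB P ε ν X L J)
    (hν : ∀ᵐ v ∂ν, ∀ j, v j ∈ Set.Icc (0 : ℝ) 1) (j : Fin K) {a : ℝ} (ha : 0 ≤ a) (r t : ℕ) :
    P {ω | totalSize r ≤ pulls (fun s => J s ω) j t ∧ arraySize r * a ≤
      |centredSum (fun s => J s ω) j (fun s => X s ω) (armMean ν j) r t|} ≤
      2 * ENNReal.ofReal (Real.exp (-(2 * (arraySize r * a ^ 2)))) := by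
  have hn : (0 : ℝ) < arraySize r := by exact_mod_cast arraySize_pos r
  -- The choice `c = 4 * a` maximizes `c * a - c ^ 2 / 8`, with value `2 * a ^ 2`.
  have h1 := h.measure_le_centredSum hν j (4 * a) (2 * (arraySize r * a ^ 2)) r t
  have h2 := h.measure_le_centredSum hν j (-(4 * a)) (2 * (arraySize r * a ^ 2)) r t
  rw [two_mul]
  refine (measure_mono ?_).trans ((measure_union_le _ _).trans (add_le_add h1 h2))
  rintro ω ⟨h3, h4⟩
  rcases le_abs.1 h4 with h5 | h5
  · refine Or.inl ⟨h3, ?_⟩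
    have := mul_le_mul_of_nonneg_left h5 ha
    nlinarith
  · refine Or.inr ⟨h3, ?_⟩
    have := mul_le_mul_of_nonneg_left h5 ha
    nlinarith

theorem measure_lt_abs_noise (h : IsAnytimeLazyUCB P ε ν X L J) (hε : 0 < ε) (j : Fin K) (r : ℕ)
    {c : ℝ} (hc : 0 ≤ c) :
    P {ω | c / ε < |L ω j r|} ≤ ENNReal.ofReal (Real.exp (-c)) := by
  rw [(h.noise_law j r).measure_eq (p := fun y => c / ε < |y|)
    (measurableSet_lt measurable_const measurable_id.abs)]
  refine (laplace_lt_abs (by positivity) (by positivity)).trans_eq ?_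
  congr 2
  field_simp

theorem measure_not_accurate_le [IsProbabilityMeasure P] (h : IsAnytimeLazyUCB P ε ν X L J) (hε : 0 < ε)
    (hν : ∀ᵐ v ∂ν, ∀ j, v j ∈ Set.Icc (0 : ℝ) 1) (j : Fin K) {t : ℕ} (ht : 1 ≤ t) :
    P {ω | ¬ Accurate (fun s => J s ω) ε (fun s => X s ω) (L ω) j (armMean ν j) t} ≤
      ENNReal.ofReal (3 * (1 / (t : ℝ) ^ 2)) := by
  have ht1 : (1 : ℝ) ≤ t := by exact_mod_cast ht
  have ht0 : (0 : ℝ) < t := by linarith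
  have hlog : 0 ≤ Real.log t := Real.log_nonneg ht1
  have hexp : Real.exp (-(3 * Real.log t)) = 1 / (t : ℝ) ^ 3 := by
    rw [Real.exp_neg, ← Nat.cast_ofNat, Real.exp_nat_mul, Real.exp_log ht0, one_div]
  have key : ∀ r, P ({ω | totalSize r ≤ pulls (fun s => J s ω) j (t - 1) ∧
      arraySize r * Real.sqrt (3 * Real.log t / arraySize r) ≤
      |centredSum (fun s => J s ω) j (fun s => X s ω) (armMean ν j) r (t - 1)|} ∪
      {ω | 3 * Real.log t / ε < |L ω j r|}) ≤ ENNReal.ofReal (3 * (1 / (t : ℝ) ^ 3)) := by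
    intro r
    have hn : (0 : ℝ) < arraySize r := by exact_mod_cast arraySize_pos r
    have h1 := h.measure_le_abs_centredSum hν j
      (Real.sqrt_nonneg (3 * Real.log t / arraySize r)) r (t - 1)
    have h2 := h.measure_lt_abs_noise hε j r (c := 3 * Real.log t) (by positivity)
    rw [Real.sq_sqrt (by positivity), mul_div_cancel₀ _ hn.ne'] at h1
    refine (measure_union_le _ _).trans ((add_le_add h1 h2).trans ?_)
    -- The sum deviates with probability of order `t ^ (-6)`; it is weakened to match the noise tail
    -- `t ^ (-3)`.
    have h3 : Real.exp (-(2 * (3 * Real.log t))) ≤ 1 / (t : ℝ) ^ 3 := by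
      rw [← hexp, Real.exp_le_exp]
      linarith
    rw [hexp, ← ENNReal.ofReal_ofNat 2, ← ENNReal.ofReal_mul (by positivity),
      ← ENNReal.ofReal_add (by positivity) (by positivity)]
    exact ENNReal.ofReal_le_ofReal (by linarith)
  -- The union over `t` possible indices costs one power of `t`.
  calc _ ≤ P (⋃ r ∈ Finset.range t, _) := measure_mono ?_
    _ ≤ ∑ r ∈ Finset.range t, _ := measure_biUnion_finset_le _ _
    _ ≤ ∑ r ∈ Finset.range t, _ := Finset.sum_le_sum fun r _ => key r
    _ = _ := ?_
  · intro ω hω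
    simp only [Set.mem_ofPred_eq, Accurate, not_forall] at hω
    obtain ⟨r, hr, hω⟩ := hω
    simp only [Set.mem_iUnion]
    refine ⟨r, Finset.mem_range.2 hr, ?_⟩
    rw [not_and_or] at hω
    rcases hω with hω | hω
    · left
      push Not at hω
      exact hω
    · right
      exact not_le.1 hω
  · rw [Finset.sum_const, Finset.card_range, nsmul_eq_mul, ← ENNReal.ofReal_natCast,
      ← ENNReal.ofReal_mul (by positivity)]
    congr 1
    field_simp

end IsAnytimeLazyUCB

/-! ### Gaps, expected pulls and the decomposition of the regret. -/

theorem armMean_add_gap_eq {K : ℕ} (ν : Measure (Fin K → ℝ)) (j : Fin K) :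
    ∃ i, armMean ν i = armMean ν j + gap ν j := by
  have : Nonempty (Fin K) := ⟨j⟩
  obtain ⟨i, hi⟩ := exists_eq_ciSup_of_finite (f := armMean ν)
  exact ⟨i, by rw [hi, gap]; ring⟩

theorem armMean_sub_le_gap {K : ℕ} (ν : Measure (Fin K → ℝ)) (i j : Fin K) :
    armMean ν i - armMean ν j ≤ gap ν j :=
  sub_le_sub_right (le_ciSup (Set.finite_range (armMean ν)).bddAbove i) _

theorem gap_nonneg {K : ℕ} (ν : Measure (Fin K → ℝ)) (j : Fin K) : 0 ≤ gap ν j := by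
  simpa using armMean_sub_le_gap ν j j

namespace IsAnytimeLazyUCB

variable {Ω : Type*} [MeasurableSpace Ω] {P : Measure Ω} {K : ℕ} {ε : ℝ}
  {ν : Measure (Fin K → ℝ)} {X : ℕ → Ω → Fin K → ℝ} {L : Ω → Fin K → ℕ → ℝ} {J : ℕ → Ω → Fin K}

/-- The sum is the expectation of a number of rounds that is at most `M` on every path. -/
theorem sum_measure_pulls_le [IsProbabilityMeasure P] (h : IsAnytimeLazyUCB P ε ν X L J) (j : Fin K) (M T : ℕ) :
    ∑ t ∈ Finset.Icc 1 T, P {ω | J t ω = j ∧ pulls (fun s => J s ω) j t ≤ M} ≤ M := by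
  have hm : ∀ t, MeasurableSet {ω | J t ω = j ∧ pulls (fun s => J s ω) j t ≤ M} := fun t =>
    (h.measurable_pull t (measurableSet_singleton j)).inter
      (measurable_pulls (fun s _ _ => h.measurable_pull s) j (.of_discrete (s := {n | n ≤ M})))
  calc _ = ∫⁻ ω, ∑ t ∈ Finset.Icc 1 T,
        {ω | J t ω = j ∧ pulls (fun s => J s ω) j t ≤ M}.indicator 1 ω ∂P := by
        rw [lintegral_finsetSum _ fun t _ => measurable_one.indicator (hm t)]
        exact Finset.sum_congr rfl fun t _ => (lintegral_indicator_one (hm t)).symm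
    _ ≤ ∫⁻ _, (M : ℝ≥0∞) ∂P := by
        refine lintegral_mono fun ω => ?_
        have h1 := card_filter_pulls_le (fun s => J s ω) j M T
        rw [Finset.card_filter] at h1
        refine le_trans (le_of_eq ?_) (Nat.cast_le.2 h1)
        push_cast
        exact Finset.sum_congr rfl fun t _ => by simp [Set.indicator_apply]
    _ = M := by simp

theorem sum_measure_pull_le [IsProbabilityMeasure P] (h : IsAnytimeLazyUCB P ε ν X L J) (hε : 0 < ε)
    (hν : ∀ᵐ v ∂ν, ∀ j, v j ∈ Set.Icc (0 : ℝ) 1) {j : Fin K} (hj : 0 < gap ν j) (T : ℕ) :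
    ∑ t ∈ Finset.Icc 1 T, P.real {ω | J t ω = j} ≤
      192 * Real.log T / (gap ν j * min (gap ν j) ε) + 14 := by
  obtain ⟨i, hi⟩ := armMean_add_gap_eq ν j
  set B := 192 * Real.log T / (gap ν j * min (gap ν j) ε)
  have hB : 0 ≤ B := by
    have := Real.log_natCast_nonneg T
    have := lt_min hj hε
    positivity
  -- The pathwise bound concerns the count before round `t`; the pull in round `t` adds one.
  set M := ⌊B⌋₊ + 1 with hM
  have key : ∀ t ∈ Finset.Icc 1 T, P {ω | J t ω = j} ≤ (if t = j + 1 then 1 else 0) +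
      P {ω | J t ω = j ∧ pulls (fun s => J s ω) j t ≤ M} +
      ENNReal.ofReal (6 * (1 / (t : ℝ) ^ 2)) := by
    intro t ht
    rw [Finset.mem_Icc] at ht
    have hA := h.measure_not_accurate_le hε hν j ht.1
    have hA' := h.measure_not_accurate_le hε hν i ht.1
    calc P {ω | J t ω = j} ≤ P (({ω | t = j + 1} ∪
          {ω | J t ω = j ∧ pulls (fun s => J s ω) j t ≤ M}) ∪
          ({ω | ¬ Accurate (fun s => J s ω) ε (fun s => X s ω) (L ω) j (armMean ν j) t} ∪
          {ω | ¬ Accurate (fun s => J s ω) ε (fun s => X s ω) (L ω) i (armMean ν i) t})) := by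
          refine measure_mono_ae ?_
          filter_upwards [h.run] with ω hω (hJ : J t ω = j)
          by_contra hcon
          have hcon' : ¬ ((t = j + 1 ∨ (J t ω = j ∧ pulls (fun s => J s ω) j t ≤ M)) ∨
            (¬ Accurate (fun s => J s ω) ε (fun s => X s ω) (L ω) j (armMean ν j) t ∨
            ¬ Accurate (fun s => J s ω) ε (fun s => X s ω) (L ω) i (armMean ν i) t)) := hcon
          push Not at hcon'
          obtain ⟨⟨h1, h2⟩, h3, h4⟩ := hcon'
          rw [hi] at h4
          have h5 := h2 hJ
          rcases le_or_gt t K with htK | htK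
          · have h6 := hω.1 ⟨t - 1, by omega⟩
            simp only [Nat.sub_add_cancel ht.1, hJ] at h6
            have h7 := congrArg Fin.val h6
            simp only at h7
            omega
          · have h6 : _ ≤ ⌊B⌋₊ := hω.pulls_le_of_accurate hε hj htK ht.2 hJ h3 h4
            have h7 := pulls_succ (fun s => J s ω) j (t - 1)
            rw [Nat.sub_add_cancel ht.1, if_pos hJ] at h7
            omega
      _ ≤ _ := (measure_union_le _ _).trans (add_le_add (measure_union_le _ _)
          (measure_union_le _ _))
      _ ≤ _ := by
          rw [show 6 * (1 / (t : ℝ) ^ 2) = 3 * (1 / (t : ℝ) ^ 2) + 3 * (1 / (t : ℝ) ^ 2) by ring,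
            ENNReal.ofReal_add (by positivity) (by positivity)]
          gcongr
          split_ifs with h1 <;> simp [h1]
  -- Here 14 is 1 for the initial pull, 1 for the rounding in `M`, and 12 for the inaccurate rounds
  -- of two arms.
  have hsum : ∑ t ∈ Finset.Icc 1 T, P {ω | J t ω = j} ≤ ENNReal.ofReal (B + 14) := by
    refine (Finset.sum_le_sum key).trans ?_
    rw [Finset.sum_add_distrib, Finset.sum_add_distrib, ← ENNReal.ofReal_sum_of_nonneg
      (fun t _ => by positivity), ← Finset.mul_sum, Finset.sum_ite_eq']
    have h1 := h.sum_measure_pulls_le j M T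
    have h2 : ENNReal.ofReal (6 * ∑ t ∈ Finset.Icc 1 T, 1 / (t : ℝ) ^ 2) ≤ ENNReal.ofReal 12 :=
      ENNReal.ofReal_le_ofReal (by linarith [sum_inv_sq_le T])
    have h3 : (M : ℝ≥0∞) ≤ ENNReal.ofReal (B + 1) := by
      rw [← ENNReal.ofReal_natCast]
      refine ENNReal.ofReal_le_ofReal ?_
      rw [hM]
      push_cast
      linarith [Nat.floor_le hB]
    calc _ ≤ ENNReal.ofReal 1 + ENNReal.ofReal (B + 1) + ENNReal.ofReal 12 := by
          gcongr
          · rw [ENNReal.ofReal_one]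
            split_ifs <;> simp
          · exact h1.trans h3
      _ = ENNReal.ofReal (B + 14) := by
          rw [← ENNReal.ofReal_add (by positivity) (by positivity),
            ← ENNReal.ofReal_add (by positivity) (by positivity)]
          congr 1
          ring
  simp only [Measure.real]
  rw [← ENNReal.toReal_sum fun t _ => measure_ne_top _ _]
  exact ENNReal.toReal_le_of_le_ofReal (by positivity) hsum

theorem indepFun_reward_pull (h : IsAnytimeLazyUCB P ε ν X L J) {t : ℕ} (ht : 1 ≤ t) :
    IndepFun (X t) (J t) P :=
  indep_of_indep_of_le_right (h.reward_indep t ht)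
    (measurable_iff_comap_le.1 (measurable_past_pull (X := X) (L := L) ht le_rfl))

/-- Splitting over the value of `J t`, independence factors each term into a difference of means
times the probability of the pull. -/
theorem integrable_and_integral_regret_le [IsProbabilityMeasure P] (h : IsAnytimeLazyUCB P ε ν X L J)
    (hν : ∀ᵐ v ∂ν, ∀ j, v j ∈ Set.Icc (0 : ℝ) 1) {t : ℕ} (ht : 1 ≤ t) (i : Fin K) :
    Integrable (fun ω => X t ω i - X t ω (J t ω)) P ∧
    ∫ ω, (X t ω i - X t ω (J t ω)) ∂P ≤ ∑ j, gap ν j * P.real {ω | J t ω = j} := by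
  have hm : ∀ j, MeasurableSet {ω | J t ω = j} := fun j =>
    h.measurable_pull t (measurableSet_singleton j)
  have heq : (fun ω => X t ω i - X t ω (J t ω)) =
      fun ω => ∑ j, (X t ω i - X t ω j) * {ω | J t ω = j}.indicator 1 ω := by
    ext ω
    simp [Set.indicator_apply]
  have hint : ∀ j, Integrable (fun ω => X t ω i - X t ω j) P := fun j =>
    (h.integrable_reward hν ht i).sub (h.integrable_reward hν ht j)
  have hint' : ∀ j, Integrable
      (fun ω => (X t ω i - X t ω j) * {ω | J t ω = j}.indicator 1 ω) P := by
    intro j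
    have : (fun ω => (X t ω i - X t ω j) * {ω | J t ω = j}.indicator 1 ω) =
        {ω | J t ω = j}.indicator fun ω => X t ω i - X t ω j := by
      ext ω
      simp [Set.indicator_apply]
    rw [this]
    exact (hint j).indicator (hm j)
  rw [heq]
  refine ⟨integrable_finsetSum _ fun j _ => hint' j, ?_⟩
  rw [integral_finsetSum _ fun j _ => hint' j]
  refine Finset.sum_le_sum fun j _ => ?_
  have hφ : Measurable fun v : Fin K → ℝ => v i - v j := by fun_prop
  have hψ : Measurable (({j} : Set (Fin K)).indicator (1 : Fin K → ℝ)) :=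
    measurable_one.indicator (measurableSet_singleton j)
  have hind := (h.indepFun_reward_pull ht).comp hφ hψ
  have := hind.integral_fun_mul_eq_mul_integral (hint j).aestronglyMeasurable
    (hψ.comp (h.measurable_pull t)).aestronglyMeasurable
  have hi1 : ∫ ω, ((fun v : Fin K → ℝ => v i - v j) ∘ X t) ω ∂P = armMean ν i - armMean ν j := by
    simp only [Function.comp]
    rw [integral_sub (h.integrable_reward hν ht i) (h.integrable_reward hν ht j),
      h.integral_reward ht, h.integral_reward ht]
  have hi2 : ∫ ω, ((({j} : Set (Fin K)).indicator (1 : Fin K → ℝ)) ∘ J t) ω ∂P =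
      P.real {ω | J t ω = j} := by
    rw [← integral_indicator_one (hm j)]
    refine integral_congr_ae (Filter.Eventually.of_forall fun ω => ?_)
    simp [Set.indicator_apply, Pi.single_apply]
  rw [hi1, hi2] at this
  refine le_trans (le_of_eq ?_) (mul_le_mul_of_nonneg_right (armMean_sub_le_gap ν i j)
    measureReal_nonneg)
  rw [← this]
  refine integral_congr_ae (Filter.Eventually.of_forall fun ω => ?_)
  simp [Set.indicator_apply, Pi.single_apply]

theorem regret_le_sum_gap_mul [IsProbabilityMeasure P] (h : IsAnytimeLazyUCB P ε ν X L J)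
    (hν : ∀ᵐ v ∂ν, ∀ j, v j ∈ Set.Icc (0 : ℝ) 1) (T : ℕ) :
    regret P X J T ≤ ∑ j, gap ν j * ∑ t ∈ Finset.Icc 1 T, P.real {ω | J t ω = j} := by
  have hnn : 0 ≤ ∑ j, gap ν j * ∑ t ∈ Finset.Icc 1 T, P.real {ω | J t ω = j} :=
    Finset.sum_nonneg fun j _ => mul_nonneg (gap_nonneg ν j)
      (Finset.sum_nonneg fun t _ => measureReal_nonneg)
  refine Real.iSup_le (fun i => ?_) hnn
  simp only [← Finset.sum_sub_distrib]
  rw [integral_finsetSum _ fun t ht =>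
    (h.integrable_and_integral_regret_le hν (Finset.mem_Icc.1 ht).1 i).1]
  simp only [Finset.mul_sum]
  rw [Finset.sum_comm]
  exact Finset.sum_le_sum fun t ht => (h.integrable_and_integral_regret_le hν (Finset.mem_Icc.1 ht).1 i).2

theorem gap_le_one [IsProbabilityMeasure P] (h : IsAnytimeLazyUCB P ε ν X L J)
    (hν : ∀ᵐ v ∂ν, ∀ j, v j ∈ Set.Icc (0 : ℝ) 1) (j : Fin K) : gap ν j ≤ 1 := by
  obtain ⟨i, hi⟩ := armMean_add_gap_eq ν j
  linarith [(h.armMean_mem_Icc hν i).2, (h.armMean_mem_Icc hν j).1]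

end IsAnytimeLazyUCB

end PrivateBandit

theorem theorem2 :
    ∃ C : ℝ, 0 < C ∧
      ∀ (Ω : Type*) [MeasurableSpace Ω] (P : Measure Ω) [IsProbabilityMeasure P]
        (K : ℕ) (ε : ℝ) (ν : Measure (Fin K → ℝ)) (X : ℕ → Ω → Fin K → ℝ)
        (L : Ω → Fin K → ℕ → ℝ) (J : ℕ → Ω → Fin K),
        0 < ε →
        (∀ᵐ v ∂ν, ∀ j, v j ∈ Set.Icc (0 : ℝ) 1) →
        PrivateBandit.IsAnytimeLazyUCB P ε ν X L J →
        ∀ T : ℕ, 2 ≤ T →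
          PrivateBandit.regret P X J T ≤
            C * ∑ j with 0 < PrivateBandit.gap ν j,
              Real.logb 2 T / min (PrivateBandit.gap ν j) ε := by
  -- 206 is 192 + 14: the additive 14 is absorbed because gaps are at most 1 and `logb 2 T` is at
  -- least 1.
  refine ⟨206, by norm_num, fun Ω _ P _ K ε ν X L J hε hν h T hT => ?_⟩
  refine (h.regret_le_sum_gap_mul hν T).trans ?_
  rw [Finset.sum_filter, Finset.mul_sum]
  refine Finset.sum_le_sum fun j _ => ?_
  split_ifs with hj
  · have h1 := h.sum_measure_pull_le hε hν hj T
    have hm : 0 < min (PrivateBandit.gap ν j) ε := lt_min hj hε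
    have hm1 : min (PrivateBandit.gap ν j) ε ≤ 1 := (min_le_left _ _).trans (h.gap_le_one hν j)
    have hT' : (2 : ℝ) ≤ T := by exact_mod_cast hT
    have hlogb : 1 ≤ Real.logb 2 T := by
      rw [Real.le_logb_iff_rpow_le (by norm_num) (by linarith)]
      simpa using hT'
    have hlog : Real.log T ≤ Real.logb 2 T := by
      rw [Real.logb, le_div_iff₀ (Real.log_pos (by norm_num))]
      exact mul_le_of_le_one_right (Real.log_natCast_nonneg T)
        (Real.log_two_lt_d9.le.trans (by norm_num))
    refine (mul_le_mul_of_nonneg_left h1 hj.le).trans ?_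
    have h2 : PrivateBandit.gap ν j * (192 * Real.log T /
        (PrivateBandit.gap ν j * min (PrivateBandit.gap ν j) ε) + 14) =
        192 * (Real.log T / min (PrivateBandit.gap ν j) ε) + 14 * PrivateBandit.gap ν j := by
      field_simp
    have h3 : Real.log T / min (PrivateBandit.gap ν j) ε ≤
        Real.logb 2 T / min (PrivateBandit.gap ν j) ε := by gcongr
    have h4 : PrivateBandit.gap ν j ≤ Real.logb 2 T / min (PrivateBandit.gap ν j) ε := by
      rw [le_div_iff₀ hm]
      nlinarith [h.gap_le_one hν j]
    linarith
  · rw [le_antisymm (not_lt.1 hj) (PrivateBandit.gap_nonneg ν j)]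
    simp
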